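/- For a Hermitian $n\times n$ complex matrix $H$ let $\lambda_1^\downarrow(H)\ge\dots\ge\lambda_n^\downarrow(H)$ be its eigenvalues, repeated according to multiplicity. A proper eigenbasis of $H$ is an orthonormal basis of $\mathbb C^n$, given by the columns of a unitary matrix $U$, with $U^*HU=\mathrm{diag}(\lambda_1^\downarrow(H),\dots,\lambda_n^\downarrow(H))$. Let $A$ be a Hermitian $n\times n$ complex matrix. For every Hermitian $n\times n$ complex matrix $B$ and every $k\le n$ the right derivative $\frac{d}{dt}\big|_{t=0^+}\sum_{j=1}^k\lambda_j^\downarrow(A+tB)$ exists, so that a real vector $\delta(B;A)$ is defined by $$\sum_{j=1}^k\delta_j(B;A)=\frac{d}{dt}\Big|_{t=0^+}\sum_{j=1}^k\lambda_j^\downarrow(A+tB),\qquad k=1,\dots,n.$$ For every Hermitian $B$ there is a proper eigenbasis $U$ of $A$ such that $\delta_j(B;A)=(U^*BU)_{jj}$ for all $j=1,\dots,n$. If all eigenvalues of $A$ are simple, then a proper eigenbasis of $A$ exists and is unique up to multiplying each basis vector by a complex number of modulus one, and $\delta_j(B;A)=(U^*BU)_{jj}$ for all $j$ holds for every proper eigenbasis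 $U$ of $A$ and every Hermitian $B$; thus the basis does not depend on $B$. If some eigenvalue of $A$ is not simple, the required basis depends on $B$: there is no proper eigenbasis $U$ of $A$ such that $\delta_j(B;A)=(U^*BU)_{jj}$ holds for all $j$ and all Hermitian $B$. -/

import Mathlib

open Matrix

/-- `A + t B` is Hermitian for Hermitian `A`, `B` and real `t`. -/
theorem isHermitian_add_smul {n : ℕ} {A B : Matrix (Fin n) (Fin n) ℂ}
    (hA : A.IsHermitian) (hB : B.IsHermitian) (t : ℝ) : (A + t • B).IsHermitian := by
  have h : (t • B).IsHermitian := by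
    unfold Matrix.IsHermitian at *
    rw [Matrix.conjTranspose_smul, hB, star_trivial]
  exact hA.add h

/-- The vector of eigenvalues of a Hermitian matrix, repeated according to multiplicity and
sorted in non-increasing order. (`Matrix.IsHermitian.eigenvalues₀` is sorted;
`Matrix.IsHermitian.eigenvalues` need not be.) -/
noncomputable def sortedEigenvalues {n : ℕ} {A : Matrix (Fin n) (Fin n) ℂ}
    (hA : A.IsHermitian) (j : Fin n) : ℝ :=
  hA.eigenvalues₀ (Fin.cast (Fintype.card_fin n).symm j)

/-- The sum of the first `k` entries of a vector. -/
def partialSum {n : ℕ} (v : Fin n → ℝ) (k : ℕ) : ℝ :=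
  ∑ j ∈ Finset.univ.filter (fun j : Fin n => (j : ℕ) < k), v j

/-- The function sending `t` to the sum of the `k` largest eigenvalues of `A + t B`. -/
noncomputable def topEigenvalueSum {n : ℕ} {A B : Matrix (Fin n) (Fin n) ℂ}
    (hA : A.IsHermitian) (hB : B.IsHermitian) (k : ℕ) (t : ℝ) : ℝ :=
  partialSum (sortedEigenvalues (isHermitian_add_smul hA hB t)) k

/-- The vector `δ(B;A)`, whose partial sums are the right derivatives at `t = 0` of the sums of
the `k` largest eigenvalues of `A + t B`; an entry is the difference of two consecutive ones
(with 0-based indices, entry `j` uses the `j + 1` and the `j` largest eigenvalues). -/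
noncomputable def delta {n : ℕ} {A B : Matrix (Fin n) (Fin n) ℂ}
    (hB : B.IsHermitian) (hA : A.IsHermitian) (j : Fin n) : ℝ :=
  derivWithin (topEigenvalueSum hA hB ((j : ℕ) + 1)) (Set.Ioi 0) 0
    - derivWithin (topEigenvalueSum hA hB (j : ℕ)) (Set.Ioi 0) 0

/-- The columns of `U` form a proper eigenbasis of `A`: an orthonormal basis in which `A` is
diagonal, the diagonal entries being the eigenvalues of `A` in non-increasing order. -/
def IsProperEigenbasis {n : ℕ} {A : Matrix (Fin n) (Fin n) ℂ}
    (hA : A.IsHermitian) (U : Matrix (Fin n) (Fin n) ℂ) : Prop :=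
  U ∈ Matrix.unitaryGroup (Fin n) ℂ ∧
    Uᴴ * A * U = Matrix.diagonal (fun j => (sortedEigenvalues hA j : ℂ))

/-- All eigenvalues of `A` have multiplicity one. -/
def HasSimpleSpectrum {n : ℕ} {A : Matrix (Fin n) (Fin n) ℂ} (hA : A.IsHermitian) : Prop :=
  Function.Injective (sortedEigenvalues hA)

/-- `δ(B;A)` is the vector of diagonal entries of `B` in the basis of the columns of `U`. -/
def DeltaEqDiagIn {n : ℕ} {A B : Matrix (Fin n) (Fin n) ℂ}
    (hB : B.IsHermitian) (hA : A.IsHermitian) (U : Matrix (Fin n) (Fin n) ℂ) : Prop :=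
  ∀ j : Fin n, (delta hB hA j : ℂ) = (Uᴴ * B * U) j j

open Filter Topology

/-! By Ky Fan's principle, the sum of the `k` largest eigenvalues of `A + t B` is the maximum over
unitary `U` of a function affine in `t`, whose constant term and slope are the `k`-th partial
diagonal sums of `A` and `B` in the basis `U`. A maximum of affine functions is convex, so the right
derivatives exist. Every proper eigenbasis of `A` is a maximizer at `t = 0`, so its slope is at most
the derivative (`IsProperEigenbasis.partialSum_diagIn_le_delta`). By compactness, maximizers at `t >
0` accumulate at a proper eigenbasis of `A` whose slopes attain the derivative for all `k` at once.

For simple spectrum, proper eigenbases differ by phases only, which leave the diagonal of `B`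
unchanged. For a repeated eigenvalue, swapping two eigenvectors violates the slope bound for a
suitable rank-one `B`. -/

/-- The real parts of the diagonal entries of `M` in the basis of the columns of `U`. -/
def diagIn {n : ℕ} (U M : Matrix (Fin n) (Fin n) ℂ) (j : Fin n) : ℝ :=
  ((Uᴴ * M * U) j j).re

/-! ### Partial sums and weighted sums of monotone vectors -/

section PartialSum

variable {n : ℕ}

theorem partialSum_zero (v : Fin n → ℝ) : partialSum v 0 = 0 := by
  simp [partialSum]

theorem partialSum_succ (v : Fin n → ℝ) (j : Fin n) :
    partialSum v ((j : ℕ) + 1) = partialSum v j + v j := by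
  have h : Finset.univ.filter (fun i : Fin n => (i : ℕ) < (j : ℕ) + 1)
      = insert j (Finset.univ.filter (fun i : Fin n => (i : ℕ) < (j : ℕ))) := by
    ext i
    simp only [Finset.mem_filter, Finset.mem_univ, true_and, Finset.mem_insert, Fin.ext_iff]
    omega
  unfold partialSum
  rw [h, Finset.sum_insert (by simp)]
  ring

/-- A vector is determined by its partial sums. -/
theorem eq_of_partialSum_eq {v w : Fin n → ℝ} (h : ∀ k ≤ n, partialSum v k = partialSum w k) :
    v = w := by
  funext j
  have h1 := h (j + 1) j.isLt
  rw [partialSum_succ, partialSum_succ, h j j.isLt.le] at h1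
  linarith

/-- Telescoping; with `g k` the right derivative of the `k`-th eigenvalue sum it recovers the
defining property of `delta`. -/
theorem eq_partialSum_of_sub {v : Fin n → ℝ} {g : ℕ → ℝ} (h0 : g 0 = 0)
    (hv : ∀ j : Fin n, v j = g ((j : ℕ) + 1) - g j) : ∀ k ≤ n, partialSum v k = g k := by
  intro k
  induction k with
  | zero => intro _; rw [partialSum_zero, h0]
  | succ k ih =>
    intro hk
    have h1 := partialSum_succ v ⟨k, hk⟩
    have h2 := hv ⟨k, hk⟩
    simp only at h1 h2
    rw [h1, ih (by omega), h2]
    ring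

/-- Weights in `[0, 1]` of total mass `k` give a weighted sum of a non-increasing vector that is
at most the sum of its first `k` entries. -/
theorem sum_mul_le_partialSum {v p : Fin n → ℝ} (hv : Antitone v) (hp0 : ∀ i, 0 ≤ p i)
    (hp1 : ∀ i, p i ≤ 1) {k : ℕ} (hk : k ≤ n) (hsum : ∑ i, p i = k) :
    ∑ i, p i * v i ≤ partialSum v k := by
  have hcard : ∑ i : Fin n, (if (i : ℕ) < k then (1 : ℝ) else 0) = k := by
    rw [Finset.sum_boole, Fin.card_filter_val_lt, min_eq_right hk]
  have hps : partialSum v k = ∑ i : Fin n, (if (i : ℕ) < k then (1 : ℝ) else 0) * v i := by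
    simp [partialSum, Finset.sum_filter]
  -- The threshold `c` is the `k`-th largest entry; for `k = 0` any value will do.
  obtain ⟨c, hc1, hc2⟩ : ∃ c : ℝ, (∀ i : Fin n, (i : ℕ) < k → c ≤ v i) ∧
      ∀ i : Fin n, ¬ (i : ℕ) < k → 0 < k → v i ≤ c := by
    rcases Nat.eq_zero_or_pos k with h0 | h0
    · exact ⟨0, fun i hi => by omega, fun i _ h => by omega⟩
    · refine ⟨v ⟨k - 1, by omega⟩, fun i hi => hv ?_, fun i hi _ => hv ?_⟩ <;>
        rw [Fin.le_def] <;> simp only <;> omega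
  rcases Nat.eq_zero_or_pos k with h0 | h0
  · subst h0
    have hz : ∀ i, p i = 0 := fun i =>
      (Finset.sum_eq_zero_iff_of_nonneg (fun i _ => hp0 i)).1 (by simpa using hsum) i
        (Finset.mem_univ i)
    simp [partialSum_zero, hz]
  -- Indicator minus weight and `v i - c` never have opposite signs. The shift by `c` costs nothing,
  -- since both weightings have mass `k`.
  · have key : 0 ≤ ∑ i : Fin n, ((if (i : ℕ) < k then (1 : ℝ) else 0) - p i) * (v i - c) := by
      refine Finset.sum_nonneg fun i _ => ?_
      split_ifs with hi
      · exact mul_nonneg (by linarith [hp1 i]) (by linarith [hc1 i hi])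
      · exact mul_nonneg_of_nonpos_of_nonpos (by linarith [hp0 i]) (by linarith [hc2 i hi h0])
    have hexp : ∑ i : Fin n, ((if (i : ℕ) < k then (1 : ℝ) else 0) - p i) * (v i - c)
        = ∑ i : Fin n, (if (i : ℕ) < k then (1 : ℝ) else 0) * v i - ∑ i, p i * v i
          - c * (∑ i : Fin n, (if (i : ℕ) < k then (1 : ℝ) else 0) - ∑ i, p i) := by
      rw [← Finset.sum_sub_distrib, ← Finset.sum_sub_distrib, Finset.mul_sum,
        ← Finset.sum_sub_distrib]
      exact Finset.sum_congr rfl fun i _ => by ring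
    rw [hexp, hcard, hsum, ← hps] at key
    linarith

end PartialSum

/-! ### Proper eigenbases, Ky Fan's inequality, compactness -/

section Eigenbasis

variable {n : ℕ} {A B M : Matrix (Fin n) (Fin n) ℂ}

theorem sortedEigenvalues_antitone (hA : A.IsHermitian) : Antitone (sortedEigenvalues hA) :=
  fun _ _ h => hA.eigenvalues₀_antitone h

theorem sum_normSq_row {W : Matrix (Fin n) (Fin n) ℂ} (hW : W ∈ Matrix.unitaryGroup (Fin n) ℂ)
    (i : Fin n) : ∑ j, Complex.normSq (W i j) = 1 := by
  have h := congrFun (congrFun (Matrix.mem_unitaryGroup_iff.1 hW) i) i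
  rw [Matrix.mul_apply, Matrix.one_apply_eq] at h
  have h' := congrArg Complex.re h
  simpa [Matrix.star_apply, Complex.mul_conj] using h'

theorem sum_normSq_col {W : Matrix (Fin n) (Fin n) ℂ} (hW : W ∈ Matrix.unitaryGroup (Fin n) ℂ)
    (j : Fin n) : ∑ i, Complex.normSq (W i j) = 1 := by
  have h := congrFun (congrFun (Matrix.mem_unitaryGroup_iff'.1 hW) j) j
  rw [Matrix.mul_apply, Matrix.one_apply_eq] at h
  have h' := congrArg Complex.re h
  simpa [Matrix.star_apply, Complex.normSq_apply] using h'

theorem diagIn_diagonal (W : Matrix (Fin n) (Fin n) ℂ) (d : Fin n → ℝ) (j : Fin n) :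
    diagIn W (Matrix.diagonal fun i => (d i : ℂ)) j = ∑ i, Complex.normSq (W i j) * d i := by
  unfold diagIn
  rw [Matrix.mul_apply, Complex.re_sum]
  refine Finset.sum_congr rfl fun i _ => ?_
  rw [Matrix.mul_diagonal, Matrix.conjTranspose_apply]
  simp [Complex.normSq_apply]
  ring

theorem IsProperEigenbasis.conjTranspose_mul_self {hA : A.IsHermitian}
    {U : Matrix (Fin n) (Fin n) ℂ} (hU : IsProperEigenbasis hA U) : Uᴴ * U = 1 :=
  Matrix.mem_unitaryGroup_iff'.1 hU.1

theorem IsProperEigenbasis.mul_conjTranspose_self {hA : A.IsHermitian}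
    {U : Matrix (Fin n) (Fin n) ℂ} (hU : IsProperEigenbasis hA U) : U * Uᴴ = 1 :=
  Matrix.mem_unitaryGroup_iff.1 hU.1

theorem IsProperEigenbasis.eq_conj {hA : A.IsHermitian} {U : Matrix (Fin n) (Fin n) ℂ}
    (hU : IsProperEigenbasis hA U) :
    A = U * Matrix.diagonal (fun j => (sortedEigenvalues hA j : ℂ)) * Uᴴ := by
  rw [← hU.2]
  calc A = (U * Uᴴ) * A * (U * Uᴴ) := by rw [hU.mul_conjTranspose_self]; simp
    _ = _ := by simp only [Matrix.mul_assoc]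

theorem IsProperEigenbasis.diagIn_self {hA : A.IsHermitian} {U : Matrix (Fin n) (Fin n) ℂ}
    (hU : IsProperEigenbasis hA U) : diagIn U A = sortedEigenvalues hA := by
  funext j
  unfold diagIn
  rw [hU.2]
  simp

theorem exists_isProperEigenbasis (hA : A.IsHermitian) : ∃ U, IsProperEigenbasis hA U := by
  -- The reindexing that puts the columns of `eigenvectorUnitary` in the order of the sorted
  -- eigenvalues.
  let e : Fin n ≃ Fin n := (finCongr (Fintype.card_fin n)).symm.trans
    (Fintype.equivOfCardEq (Fintype.card_fin _))
  let V : Matrix (Fin n) (Fin n) ℂ := hA.eigenvectorUnitary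
  have hV : Vᴴ * V = 1 := Matrix.mem_unitaryGroup_iff'.1 hA.eigenvectorUnitary.2
  have hd : Vᴴ * A * V = Matrix.diagonal (fun i => (hA.eigenvalues i : ℂ)) := by
    have h := hA.conjStarAlgAut_star_eigenvectorUnitary
    rw [Unitary.conjStarAlgAut_star_apply] at h
    exact h
  refine ⟨V.submatrix id e, Matrix.mem_unitaryGroup_iff'.2 ?_, ?_⟩
  · rw [Matrix.star_eq_conjTranspose, Matrix.conjTranspose_submatrix,
      ← Matrix.submatrix_mul _ _ e id e Function.bijective_id, hV]
    simp
  · have h1 : (V.submatrix id e)ᴴ * A * V.submatrix id e = (Vᴴ * A * V).submatrix e e := by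
      ext i j
      simp [Matrix.mul_apply, Matrix.conjTranspose_apply]
    rw [h1, hd]
    ext i j
    by_cases hij : i = j
    · subst hij
      simp [sortedEigenvalues, Matrix.IsHermitian.eigenvalues, e]
    · simp [hij]

/-- **Ky Fan's inequality**: the sum of `k` diagonal entries in an orthonormal basis is at most
the sum of the `k` largest eigenvalues. -/
theorem partialSum_diagIn_le (hM : M.IsHermitian) {U : Matrix (Fin n) (Fin n) ℂ}
    (hU : U ∈ Matrix.unitaryGroup (Fin n) ℂ) {k : ℕ} (hk : k ≤ n) :
    partialSum (diagIn U M) k ≤ partialSum (sortedEigenvalues hM) k := by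
  obtain ⟨V, hV⟩ := exists_isProperEigenbasis hM
  have hW : Vᴴ * U ∈ Matrix.unitaryGroup (Fin n) ℂ := mul_mem (Unitary.star_mem hV.1) hU
  set W := Vᴴ * U with hWdef
  have hdiag : ∀ j, diagIn U M j = ∑ i, Complex.normSq (W i j) * sortedEigenvalues hM i := by
    intro j
    rw [← diagIn_diagonal]
    unfold diagIn
    conv_lhs => rw [hV.eq_conj]
    rw [hWdef, Matrix.conjTranspose_mul, Matrix.conjTranspose_conjTranspose]
    simp only [Matrix.mul_assoc]
  -- The squared length of the projection of the `i`-th eigenvector onto the span of the first `k`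
  -- columns of `U`. Row sums bound it by 1; column sums give total mass `k`.
  let p : Fin n → ℝ := fun i =>
    ∑ j ∈ Finset.univ.filter (fun j : Fin n => (j : ℕ) < k), Complex.normSq (W i j)
  have hp : partialSum (diagIn U M) k = ∑ i, p i * sortedEigenvalues hM i := by
    simp only [partialSum, hdiag, p, Finset.sum_mul]
    exact Finset.sum_comm
  rw [hp]
  refine sum_mul_le_partialSum (sortedEigenvalues_antitone hM)
    (fun i => Finset.sum_nonneg fun j _ => Complex.normSq_nonneg _) (fun i => ?_) hk ?_
  · rw [← sum_normSq_row hW i]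
    exact Finset.sum_le_sum_of_subset_of_nonneg (Finset.filter_subset _ _)
      fun j _ _ => Complex.normSq_nonneg _
  · rw [Finset.sum_comm, Finset.sum_congr rfl fun j _ => sum_normSq_col hW j,
      Finset.sum_const, Fin.card_filter_val_lt, min_eq_right hk]
    simp

theorem partialSum_diagIn_add_smul (U A B : Matrix (Fin n) (Fin n) ℂ) (t : ℝ) (k : ℕ) :
    partialSum (diagIn U (A + t • B)) k
      = partialSum (diagIn U A) k + t * partialSum (diagIn U B) k := by
  unfold partialSum
  rw [Finset.mul_sum, ← Finset.sum_add_distrib]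
  refine Finset.sum_congr rfl fun j _ => ?_
  simp [diagIn, Matrix.mul_add, Matrix.add_mul]

theorem conj_apply_self_eq_diagIn (hB : B.IsHermitian) (U : Matrix (Fin n) (Fin n) ℂ)
    (j : Fin n) : (Uᴴ * B * U) j j = (diagIn U B j : ℂ) := by
  have h : (Uᴴ * B * U).IsHermitian := Matrix.isHermitian_conjTranspose_mul_mul U hB
  exact (h.coe_re_apply_self j).symm

theorem isCompact_unitaryGroup :
    IsCompact (Matrix.unitaryGroup (Fin n) ℂ : Set (Matrix (Fin n) (Fin n) ℂ)) := by
  have hK : IsCompact (Set.univ.pi fun _ : Fin n => Set.univ.pi fun _ : Fin n =>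
      Metric.closedBall (0 : ℂ) 1) :=
    isCompact_univ_pi fun _ => isCompact_univ_pi fun _ => isCompact_closedBall 0 1
  refine hK.of_isClosed_subset ?_ fun U hU => ?_
  · have h : (Matrix.unitaryGroup (Fin n) ℂ : Set (Matrix (Fin n) (Fin n) ℂ))
        = {U | U * star U = 1} := by
      ext U
      exact Matrix.mem_unitaryGroup_iff
    rw [h]
    exact isClosed_eq (by fun_prop) continuous_const
  · simp only [Set.mem_pi, Set.mem_univ, true_imp_iff, mem_closedBall_zero_iff]
    exact fun i j => entry_norm_bound_of_unitary hU i j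

end Eigenbasis

/-! ### Convexity in `t` and the right derivative at 0 -/

section Derivative

variable {n : ℕ} {A B : Matrix (Fin n) (Fin n) ℂ}

theorem topEigenvalueSum_zero (hA : A.IsHermitian) (hB : B.IsHermitian) (k : ℕ) :
    topEigenvalueSum hA hB k 0 = partialSum (sortedEigenvalues hA) k := by
  have h : ∀ (C : Matrix (Fin n) (Fin n) ℂ) (hC : C.IsHermitian), C = A →
      sortedEigenvalues hC = sortedEigenvalues hA := by
    rintro C hC rfl
    rfl
  unfold topEigenvalueSum
  rw [h _ _ (by simp)]

theorem partialSum_add_le_topEigenvalueSum (hA : A.IsHermitian) (hB : B.IsHermitian)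
    {U : Matrix (Fin n) (Fin n) ℂ} (hU : U ∈ Matrix.unitaryGroup (Fin n) ℂ) {k : ℕ} (hk : k ≤ n)
    (t : ℝ) : partialSum (diagIn U A) k + t * partialSum (diagIn U B) k
      ≤ topEigenvalueSum hA hB k t := by
  rw [← partialSum_diagIn_add_smul]
  exact partialSum_diagIn_le _ hU hk

theorem IsProperEigenbasis.topEigenvalueSum_eq {hA : A.IsHermitian} {hB : B.IsHermitian} {t : ℝ}
    {U : Matrix (Fin n) (Fin n) ℂ} (hU : IsProperEigenbasis (isHermitian_add_smul hA hB t) U)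
    (k : ℕ) : topEigenvalueSum hA hB k t
      = partialSum (diagIn U A) k + t * partialSum (diagIn U B) k := by
  rw [← partialSum_diagIn_add_smul, hU.diagIn_self]
  rfl

/-- An eigenbasis at the intermediate point gives an affine minorant that is exact there. -/
theorem convexOn_topEigenvalueSum (hA : A.IsHermitian) (hB : B.IsHermitian) {k : ℕ} (hk : k ≤ n) :
    ConvexOn ℝ Set.univ (topEigenvalueSum hA hB k) := by
  refine ⟨convex_univ, fun s _ t _ a b ha hb hab => ?_⟩
  obtain ⟨U, hU⟩ := exists_isProperEigenbasis (isHermitian_add_smul hA hB (a • s + b • t))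
  rw [hU.topEigenvalueSum_eq]
  have hs := mul_le_mul_of_nonneg_left (partialSum_add_le_topEigenvalueSum hA hB hU.1 hk s) ha
  have ht := mul_le_mul_of_nonneg_left (partialSum_add_le_topEigenvalueSum hA hB hU.1 hk t) hb
  obtain rfl : b = 1 - a := by linarith
  simp only [smul_eq_mul]
  linarith

theorem hasDerivWithinAt_topEigenvalueSum (hA : A.IsHermitian) (hB : B.IsHermitian) {k : ℕ}
    (hk : k ≤ n) : HasDerivWithinAt (topEigenvalueSum hA hB k)
      (partialSum (delta hB hA) k) (Set.Ioi 0) 0 := by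
  have h0 : derivWithin (topEigenvalueSum hA hB 0) (Set.Ioi 0) 0 = 0 := by
    have : topEigenvalueSum hA hB 0 = fun _ => 0 := by
      funext t
      exact partialSum_zero _
    rw [this]
    simp
  rw [eq_partialSum_of_sub (v := delta hB hA)
    (g := fun k => derivWithin (topEigenvalueSum hA hB k) (Set.Ioi 0) 0) h0 (fun _ => rfl) k hk]
  exact (convexOn_topEigenvalueSum hA hB hk).hasDerivWithinAt_rightDeriv_of_mem_interior (by simp)

theorem tendsto_slope_topEigenvalueSum (hA : A.IsHermitian) (hB : B.IsHermitian) {k : ℕ}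
    (hk : k ≤ n) : Tendsto (slope (topEigenvalueSum hA hB k) 0) (𝓝[>] 0)
      (𝓝 (partialSum (delta hB hA) k)) :=
  (hasDerivWithinAt_iff_tendsto_slope' (by simp)).1 (hasDerivWithinAt_topEigenvalueSum hA hB hk)

/-- The diagonal of `B` in any proper eigenbasis of `A` has partial sums at most those of
`δ(B;A)`. -/
theorem IsProperEigenbasis.partialSum_diagIn_le_delta {hA : A.IsHermitian} (hB : B.IsHermitian)
    {U : Matrix (Fin n) (Fin n) ℂ} (hU : IsProperEigenbasis hA U) {k : ℕ} (hk : k ≤ n) :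
    partialSum (diagIn U B) k ≤ partialSum (delta hB hA) k := by
  refine ge_of_tendsto (tendsto_slope_topEigenvalueSum hA hB hk) ?_
  filter_upwards [self_mem_nhdsWithin] with t ht
  have ht' : (0 : ℝ) < t := ht
  have h := partialSum_add_le_topEigenvalueSum hA hB hU.1 hk t
  rw [hU.diagIn_self] at h
  rw [slope_def_field, topEigenvalueSum_zero, le_div_iff₀ (by linarith)]
  linarith

/-- A unitary matrix in which the partial diagonal sums of `A` attain the Ky Fan bounds, and which
diagonalizes `A`, is a proper eigenbasis. -/
theorem isProperEigenbasis_of_partialSum_eq {hA : A.IsHermitian} {U : Matrix (Fin n) (Fin n) ℂ}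
    (hU : U ∈ Matrix.unitaryGroup (Fin n) ℂ) (hoff : ∀ i j, i ≠ j → (Uᴴ * A * U) i j = 0)
    (hsum : ∀ k ≤ n, partialSum (diagIn U A) k = partialSum (sortedEigenvalues hA) k) :
    IsProperEigenbasis hA U := by
  refine ⟨hU, ?_⟩
  ext i j
  by_cases hij : i = j
  · subst hij
    rw [conj_apply_self_eq_diagIn hA, eq_of_partialSum_eq hsum, Matrix.diagonal_apply_eq]
  · rw [hoff i j hij, Matrix.diagonal_apply_ne _ hij]

theorem deltaEqDiagIn_iff (hA : A.IsHermitian) (hB : B.IsHermitian)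
    (U : Matrix (Fin n) (Fin n) ℂ) : DeltaEqDiagIn hB hA U ↔ delta hB hA = diagIn U B := by
  simp only [DeltaEqDiagIn, conj_apply_self_eq_diagIn hB, funext_iff, Complex.ofReal_inj]

/-- A limit point, as `t` decreases to `0`, of proper eigenbases of `A + t B` is a proper eigenbasis
of `A` in which `B` has diagonal `δ(B;A)`. -/
theorem exists_isProperEigenbasis_deltaEqDiagIn (hA : A.IsHermitian) (hB : B.IsHermitian) :
    ∃ U, IsProperEigenbasis hA U ∧ DeltaEqDiagIn hB hA U := by
  choose V hV using fun t : ℝ => exists_isProperEigenbasis (isHermitian_add_smul hA hB t)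
  obtain ⟨s, -, hs0, hslim⟩ := exists_seq_strictAnti_tendsto (0 : ℝ)
  have : FirstCountableTopology (Matrix (Fin n) (Fin n) ℂ) :=
    inferInstanceAs (FirstCountableTopology (Fin n → Fin n → ℂ))
  obtain ⟨U, hU, φ, hφ, hlim⟩ :=
    isCompact_unitaryGroup.tendsto_subseq (x := fun m => V (s m)) fun m => (hV (s m)).1
  have hτ0 : ∀ m, 0 < s (φ m) := fun m => hs0 _
  have hτ : Tendsto (fun m => s (φ m)) atTop (𝓝 0) := hslim.comp hφ.tendsto_atTop
  have hτ' : Tendsto (fun m => s (φ m)) atTop (𝓝[>] 0) :=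
    tendsto_nhdsWithin_iff.2 ⟨hτ, Eventually.of_forall hτ0⟩
  have hdiag : ∀ (C : Matrix (Fin n) (Fin n) ℂ) (k : ℕ),
      Tendsto (fun m => partialSum (diagIn (V (s (φ m))) C) k) atTop
        (𝓝 (partialSum (diagIn U C) k)) := by
    intro C k
    refine tendsto_finsetSum _ fun j _ => ?_
    have hc : Continuous fun W : Matrix (Fin n) (Fin n) ℂ => diagIn W C j := by
      unfold diagIn
      fun_prop
    exact (hc.tendsto U).comp hlim
  have hproper : IsProperEigenbasis hA U := by
    refine isProperEigenbasis_of_partialSum_eq hU (fun i j hij => ?_) fun k hk => ?_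
    -- Off-diagonal entries vanish along the sequence and are jointly continuous in `t` and the
    -- basis.
    · have hc : Continuous fun q : ℝ × Matrix (Fin n) (Fin n) ℂ =>
          (q.2ᴴ * (A + q.1 • B) * q.2) i j := by fun_prop
      have h1 := (hc.tendsto (0, U)).comp (hτ.prodMk_nhds hlim)
      have h2 : ∀ m, ((V (s (φ m)))ᴴ * (A + s (φ m) • B) * V (s (φ m))) i j = 0 := fun m => by
        rw [(hV (s (φ m))).2, Matrix.diagonal_apply_ne _ hij]
      have h3 := tendsto_nhds_unique (h1.congr h2) tendsto_const_nhds
      simpa using h3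
    -- A fixed eigenbasis `P` of `A` competes with the maximizer at each time of the sequence; the
    -- limit `U` therefore does at least as well as `P` for `A`.
    · refine le_antisymm (partialSum_diagIn_le hA hU hk) ?_
      obtain ⟨P, hP⟩ := exists_isProperEigenbasis hA
      have h1 : Tendsto (fun m => partialSum (diagIn P A) k + s (φ m) * partialSum (diagIn P B) k)
          atTop (𝓝 (partialSum (diagIn P A) k + 0 * partialSum (diagIn P B) k)) :=
        tendsto_const_nhds.add (hτ.mul_const _)
      have h2 := (hdiag A k).add (hτ.mul (hdiag B k))
      have h3 := le_of_tendsto_of_tendsto' h1 h2 fun m => by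
        rw [← (hV (s (φ m))).topEigenvalueSum_eq]
        exact partialSum_add_le_topEigenvalueSum hA hB hP.1 hk _
      simpa [hP.diagIn_self] using h3
  refine ⟨U, hproper, (deltaEqDiagIn_iff hA hB U).2 (eq_of_partialSum_eq fun k hk => ?_)⟩
  refine le_antisymm ?_ (hproper.partialSum_diagIn_le_delta hB hk)
  -- The maximizer at time `t` is at most optimal for `A`, so the difference quotient is at most its
  -- diagonal sum of `B`.
  refine le_of_tendsto_of_tendsto' ((tendsto_slope_topEigenvalueSum hA hB hk).comp hτ')
    (hdiag B k) fun m => ?_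
  rw [Function.comp_apply, slope_def_field, topEigenvalueSum_zero, sub_zero,
    div_le_iff₀ (hτ0 m), (hV (s (φ m))).topEigenvalueSum_eq]
  linarith [partialSum_diagIn_le hA (hV (s (φ m))).1 hk]

end Derivative

/-! ### Simple versus repeated eigenvalues -/

section Uniqueness

variable {n : ℕ} {A : Matrix (Fin n) (Fin n) ℂ} {hA : A.IsHermitian}

/-- The transition matrix commutes with a diagonal matrix with distinct entries, so it is diagonal;
being unitary, it has entries of modulus one. -/
theorem IsProperEigenbasis.exists_phases (hsimple : HasSimpleSpectrum hA)
    {U V : Matrix (Fin n) (Fin n) ℂ} (hU : IsProperEigenbasis hA U)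
    (hV : IsProperEigenbasis hA V) :
    ∃ c : Fin n → ℂ, (∀ j, ‖c j‖ = 1) ∧ V = U * Matrix.diagonal c := by
  set L := Matrix.diagonal (fun j => (sortedEigenvalues hA j : ℂ)) with hL
  have hcomm : L * (Uᴴ * V) = (Uᴴ * V) * L := by
    calc L * (Uᴴ * V) = Uᴴ * A * (U * Uᴴ) * V := by
          rw [hL, ← hU.2]; simp only [Matrix.mul_assoc]
      _ = Uᴴ * (V * Vᴴ) * A * V := by
        rw [hU.mul_conjTranspose_self, hV.mul_conjTranspose_self]; simp
      _ = _ := by rw [hL, ← hV.2]; simp only [Matrix.mul_assoc]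
  have hoff : ∀ i j, i ≠ j → (Uᴴ * V) i j = 0 := by
    intro i j hij
    have h := congrFun (congrFun hcomm i) j
    rw [hL, Matrix.diagonal_mul, Matrix.mul_diagonal, mul_comm] at h
    by_contra hne
    exact hij (hsimple (Complex.ofReal_injective (mul_left_cancel₀ hne h)))
  have hW : Uᴴ * V = Matrix.diagonal fun j => (Uᴴ * V) j j := by
    ext i j
    by_cases hij : i = j
    · subst hij; simp
    · rw [hoff i j hij, Matrix.diagonal_apply_ne _ hij]
  have hWu : Uᴴ * V ∈ Matrix.unitaryGroup (Fin n) ℂ := mul_mem (Unitary.star_mem hU.1) hV.1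
  refine ⟨fun j => (Uᴴ * V) j j, fun j => ?_, ?_⟩
  · have h := sum_normSq_col hWu j
    rw [Finset.sum_eq_single j (fun i _ hij => by rw [hoff i j hij, map_zero]) (by simp),
      Complex.normSq_eq_norm_sq] at h
    exact (pow_eq_one_iff_of_nonneg (norm_nonneg _) two_ne_zero).1 h
  · rw [← hW, ← Matrix.mul_assoc, hU.mul_conjTranspose_self, Matrix.one_mul]

theorem conj_mul_diagonal_apply_self (U B : Matrix (Fin n) (Fin n) ℂ) {c : Fin n → ℂ}
    (hc : ∀ j, ‖c j‖ = 1) (j : Fin n) :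
    ((U * Matrix.diagonal c)ᴴ * B * (U * Matrix.diagonal c)) j j = (Uᴴ * B * U) j j := by
  have h : (U * Matrix.diagonal c)ᴴ * B * (U * Matrix.diagonal c)
      = Matrix.diagonal (star c) * (Uᴴ * B * U) * Matrix.diagonal c := by
    rw [Matrix.conjTranspose_mul, Matrix.diagonal_conjTranspose]
    simp only [Matrix.mul_assoc]
  have hcc : star (c j) * c j = 1 := by
    rw [Complex.star_def, Complex.conj_mul', hc j]
    simp
  rw [h, Matrix.mul_diagonal, Matrix.diagonal_mul, Pi.star_apply, mul_right_comm, hcc, one_mul]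

theorem IsProperEigenbasis.deltaEqDiagIn (hsimple : HasSimpleSpectrum hA)
    {U : Matrix (Fin n) (Fin n) ℂ} (hU : IsProperEigenbasis hA U)
    {B : Matrix (Fin n) (Fin n) ℂ} (hB : B.IsHermitian) : DeltaEqDiagIn hB hA U := by
  obtain ⟨V, hV, hδ⟩ := exists_isProperEigenbasis_deltaEqDiagIn hA hB
  obtain ⟨c, hc, rfl⟩ := hU.exists_phases hsimple hV
  intro j
  rw [hδ j, conj_mul_diagonal_apply_self U B hc]

theorem IsProperEigenbasis.submatrix_swap {U : Matrix (Fin n) (Fin n) ℂ}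
    (hU : IsProperEigenbasis hA U) {i j : Fin n}
    (hij : sortedEigenvalues hA i = sortedEigenvalues hA j) :
    IsProperEigenbasis hA (U.submatrix id (Equiv.swap i j)) := by
  refine ⟨Matrix.mem_unitaryGroup_iff'.2 ?_, ?_⟩
  · rw [Matrix.star_eq_conjTranspose, Matrix.conjTranspose_submatrix,
      ← Matrix.submatrix_mul _ _ _ id _ Function.bijective_id, hU.conjTranspose_mul_self]
    simp
  · have h1 : (U.submatrix id (Equiv.swap i j))ᴴ * A * U.submatrix id (Equiv.swap i j)
        = (Uᴴ * A * U).submatrix (Equiv.swap i j) (Equiv.swap i j) := by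
      ext a b
      simp [Matrix.mul_apply, Matrix.conjTranspose_apply]
    rw [h1, hU.2, Matrix.submatrix_diagonal_equiv]
    congr 1
    funext a
    rw [Function.comp_apply, Equiv.swap_apply_def]
    split_ifs with ha hb
    · rw [ha, hij]
    · rw [hb, hij]
    · rfl

/-- If two eigenvalues coincide, then the projection onto one of the two eigenvectors of a proper
eigenbasis is a perturbation that this eigenbasis does not serve. -/
theorem IsProperEigenbasis.exists_not_deltaEqDiagIn {U : Matrix (Fin n) (Fin n) ℂ}
    (hU : IsProperEigenbasis hA U) (hsimple : ¬ HasSimpleSpectrum hA) :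
    ∃ (B : Matrix (Fin n) (Fin n) ℂ) (hB : B.IsHermitian), ¬ DeltaEqDiagIn hB hA U := by
  obtain ⟨i, j, hlt, heq⟩ : ∃ i j, i < j ∧ sortedEigenvalues hA i = sortedEigenvalues hA j := by
    simp only [HasSimpleSpectrum, Function.Injective, not_forall] at hsimple
    obtain ⟨a, b, hab, hne⟩ := hsimple
    rcases lt_or_gt_of_ne hne with h | h
    · exact ⟨a, b, h, hab⟩
    · exact ⟨b, a, h, hab.symm⟩
  -- The mass sits at the later index `j`, so swapping moves it forward to `i` and raises the sum
  -- over indices up to `i` from 0 to 1.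
  let d : Fin n → ℝ := Pi.single j 1
  let D : Matrix (Fin n) (Fin n) ℂ := Matrix.diagonal fun a => (d a : ℂ)
  have hD : D.IsHermitian := by
    refine Matrix.isHermitian_diagonal_of_self_adjoint _ ?_
    ext a
    simp
  have hB : (U * D * Uᴴ).IsHermitian := Matrix.isHermitian_mul_mul_conjTranspose U hD
  refine ⟨U * D * Uᴴ, hB, fun hδ => ?_⟩
  have hUB : Uᴴ * (U * D * Uᴴ) * U = D := by
    calc Uᴴ * (U * D * Uᴴ) * U = (Uᴴ * U) * D * (Uᴴ * U) := by simp only [Matrix.mul_assoc]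
      _ = D := by rw [hU.conjTranspose_mul_self]; simp
  have hdU : diagIn U (U * D * Uᴴ) = d := by
    funext a
    unfold diagIn
    rw [hUB]
    simp [D]
  have hdV : diagIn (U.submatrix id (Equiv.swap i j)) (U * D * Uᴴ) = d ∘ Equiv.swap i j := by
    rw [← hdU]
    funext a
    simp [diagIn, Matrix.mul_apply, Matrix.conjTranspose_apply]
  have hle := (hU.submatrix_swap heq).partialSum_diagIn_le_delta hB (k := (i : ℕ) + 1) i.isLt
  have hlt' : (i : ℕ) < j := hlt
  rw [(deltaEqDiagIn_iff hA hB U).1 hδ, hdU, hdV] at hle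
  have h0 : partialSum d ((i : ℕ) + 1) = 0 := by
    refine Finset.sum_eq_zero fun a ha => ?_
    rw [Finset.mem_filter] at ha
    exact Pi.single_eq_of_ne (fun h => by subst h; omega) _
  have h1 : (1 : ℝ) ≤ partialSum (d ∘ Equiv.swap i j) ((i : ℕ) + 1) := by
    have hd : 0 ≤ d := Pi.single_nonneg.2 zero_le_one
    have hi : i ∈ Finset.univ.filter (fun a : Fin n => (a : ℕ) < (i : ℕ) + 1) := by simp
    have h := Finset.single_le_sum (f := d ∘ Equiv.swap i j) (fun a _ => hd _) hi
    rw [Function.comp_apply, Equiv.swap_apply_left] at h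
    exact (Pi.single_eq_same (M := fun _ => ℝ) j 1).symm.le.trans h
  linarith

end Uniqueness

theorem theorem2 {n : ℕ} {A : Matrix (Fin n) (Fin n) ℂ} (hA : A.IsHermitian) :
    -- the right derivatives defining `δ(B;A)` exist, and they are its partial sums
    (∀ (B : Matrix (Fin n) (Fin n) ℂ) (hB : B.IsHermitian), ∀ k ≤ n,
      HasDerivWithinAt (topEigenvalueSum hA hB k) (partialSum (delta hB hA) k) (Set.Ioi 0) 0) ∧
    -- `δ(B;A)` is the diagonal of `B` in some proper eigenbasis of `A`
    (∀ (B : Matrix (Fin n) (Fin n) ℂ) (hB : B.IsHermitian),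
      ∃ U, IsProperEigenbasis hA U ∧ DeltaEqDiagIn hB hA U) ∧
    -- simple spectrum: the proper eigenbasis is unique up to phases, and serves every `B`
    (HasSimpleSpectrum hA →
      (∀ U V, IsProperEigenbasis hA U → IsProperEigenbasis hA V →
        ∃ c : Fin n → ℂ, (∀ j, ‖c j‖ = 1) ∧ V = U * Matrix.diagonal c) ∧
      (∃ U, IsProperEigenbasis hA U) ∧
      (∀ U, IsProperEigenbasis hA U →
        ∀ (B : Matrix (Fin n) (Fin n) ℂ) (hB : B.IsHermitian), DeltaEqDiagIn hB hA U)) ∧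
    -- otherwise the required basis depends on `B`: no proper eigenbasis serves every `B`
    (¬ HasSimpleSpectrum hA →
      ¬ ∃ U, IsProperEigenbasis hA U ∧
        ∀ (B : Matrix (Fin n) (Fin n) ℂ) (hB : B.IsHermitian), DeltaEqDiagIn hB hA U) := by
  refine ⟨fun B hB k hk => hasDerivWithinAt_topEigenvalueSum hA hB hk,
    fun B hB => exists_isProperEigenbasis_deltaEqDiagIn hA hB,
    fun hs => ⟨fun U V hU hV => hU.exists_phases hs hV, exists_isProperEigenbasis hA,
      fun U hU B hB => hU.deltaEqDiagIn hs hB⟩, ?_⟩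
  rintro hs ⟨U, hU, hall⟩
  obtain ⟨B, hB, hne⟩ := hU.exists_not_deltaEqDiagIn hs
  exact hne (hall B hB)
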